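/- Let $\mathbb K$ be a field of characteristic zero, and consider linear operators on $\mathbb K[x]$; write $\mathbf x$ for multiplication by $x$ and $D$ for the derivative. A delta operator is a linear operator $Q$ that commutes with all shifts $p(x)\mapsto p(x+a)$, $a\in\mathbb K$, and satisfies $Qx=c$ for a constant $c\neq0$; it is unitary if $c=1$. An invertible operator $\phi$ is the umbral operator for the delta operator $Q$ if $\phi 1=1$, $(\phi x^n)(0)=0$ for $n>0$, and $Q\phi x^n=n\,\phi x^{n-1}$ for all $n\ge 0$; it is unitary if $[x^n]\phi x^n=1$ for all $n$. The indicator of $Q$ is the power series $\tilde Q(t)=\sum_{k\ge0}\frac{(Qx^k)(0)}{k!}t^k$. Fractional iterates of a power series $f$ are power series $(f^s)_{s\in\mathbb K}$ without constant term with $f^1=f$ and $f^r\circ f^s=f^{r+s}$ for all $r,s\in\mathbb K$; when they depend regularly on $s$, the iterative logarithm is $\operatorname{itlog}(f)=\frac{d}{ds}f^s\big|_{s=0}$, taken coefficientwise. Let $\phi$ be the umbral operator for a delta operator $Q$. Then $Q=\tilde Q(D)$, and $\phi$ is unitary if and only if $Q$ is. (1) Suppose $\phi$ is unitary. Then $\tilde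 Q$ has exactly one family of fractional iterates $\tilde Q^s$ whose coefficients are polynomials in $s$; let $\operatorname{itlog}(\tilde Q)$ be defined by it and put $Q_*=\operatorname{itlog}(\tilde Q)(D)$. The operator $\mathbf xQ_*$ is locally nilpotent (each polynomial is annihilated by some power of it), and $$\phi=e^{-\mathbf xQ_*}.$$ Moreover, for $s\in\mathbb K$ put $\phi^s=e^{-s\,\mathbf xQ_*}$. Then $\phi^{r+s}=\phi^r\phi^s$ for all $r,s\in\mathbb K$; for $s\in\mathbb Z$ this is the usual power of $\phi$; and for every $s\in\mathbb K$ the operator $\phi^s$ is again a unitary umbral operator, namely the one for the delta operator $\tilde Q^s(D)$. (2) Suppose $\mathbb K$ is $\mathbb R$ or $\mathbb C$, with $Q$ not necessarily unitary. For any family $(\tilde Q^s)_{s\in\mathbb K}$ of fractional iterates of $\tilde Q$ whose coefficients are differentiable in $s$ at $s=0$, with $Q_*=\big(\frac{d}{ds}\tilde Q^s\big|_{s=0}\big)(D)$, one has $\phi=e^{-\mathbf xQ_*}$, where the exponential series, applied to any polynomial, converges coefficientwise. -/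

import Mathlib

open scoped Polynomial PowerSeries

namespace Umbral

noncomputable section

section Field

variable {K : Type*} [Field K]

/-- Linear operators on univariate polynomials; the product is composition. -/
abbrev Op (K : Type*) [Field K] := Module.End K K[X]

/-- Multiplication by the variable. -/
def mulX : Op K := LinearMap.mulLeft K (Polynomial.X : K[X])

/-- The derivative. -/
def D : Op K := Polynomial.derivative

/-- `g(D) = ∑ k, g_k D ^ k`. On `x ^ n` the terms with `k > n` vanish. -/
def seriesOp (g : K⟦X⟧) : Op K :=
  (Polynomial.basisMonomials K).constr K fun n =>
    ∑ k ∈ Finset.range (n + 1), PowerSeries.coeff k g • (D ^ k) (Polynomial.X ^ n : K[X])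

/-- Shift-invariance; `Polynomial.taylor a` is the shift `p(x) ↦ p(x + a)`. -/
def IsShiftInvariant (U : Op K) : Prop :=
  ∀ a : K, Commute U (Polynomial.taylor a : Op K)

/-- Delta operators: shift-invariant, with `Q x` a nonzero constant. -/
def IsDelta (Q : Op K) : Prop :=
  IsShiftInvariant Q ∧ ∃ c : K, c ≠ 0 ∧ Q Polynomial.X = Polynomial.C c

/-- Unitary delta operators: `Q x = 1`. -/
def IsUnitaryDelta (Q : Op K) : Prop :=
  IsShiftInvariant Q ∧ Q Polynomial.X = 1

/-- `φ` is the umbral operator for (is basic for) the delta operator `Q`. -/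
structure IsUmbralFor (φ Q : Op K) : Prop where
  delta : IsDelta Q
  invertible : IsUnit φ
  sheffer : ∀ n : ℕ, Q (φ (Polynomial.X ^ n)) = (n : K) • φ (Polynomial.X ^ (n - 1))
  zeroth : φ 1 = 1
  eval_zero : ∀ n : ℕ, 0 < n → (φ (Polynomial.X ^ n)).eval 0 = 0

/-- `φ` is unitary: `φ x ^ n` has `x ^ n`-coefficient `1`. -/
def IsUnitaryOp (φ : Op K) : Prop :=
  ∀ n : ℕ, (φ (Polynomial.X ^ n)).coeff n = 1

/-- The indicator of a shift-invariant operator `T`, the power series `∑ k, (T x ^ k)(0) / k! t ^ k`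
for which `seriesOp (indicator T) = T`. -/
def indicator (T : Op K) : K⟦X⟧ :=
  PowerSeries.mk fun k => (T (Polynomial.X ^ k)).eval 0 / (k.factorial : K)

/-- `F` is a one-parameter group of compositional iterates of `f`: `f¹ = f` and
`f^r ∘ f^s = f^(r+s)`, where `PowerSeries.subst a g` is `g ∘ a`. -/
structure IsIteration (f : K⟦X⟧) (F : K → K⟦X⟧) : Prop where
  constantCoeff : ∀ s, PowerSeries.constantCoeff (F s) = 0
  one : F 1 = f
  comp : ∀ r s, PowerSeries.subst (F s) (F r) = F (r + s)

/-- Evaluate at `s` a power series whose coefficients are polynomials in a parameter. -/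
def atParam (F : PowerSeries K[X]) (s : K) : K⟦X⟧ :=
  PowerSeries.map (Polynomial.evalRingHom s) F

/-- `F` gives fractional iterates of `f` whose coefficients are polynomials in the exponent. -/
def IsFractionalIteration (f : K⟦X⟧) (F : PowerSeries K[X]) : Prop :=
  IsIteration f (atParam F)

open Classical in
/-- The fractional iteration of `f` (zero if there is none). -/
def fractionalIteration (f : K⟦X⟧) : PowerSeries K[X] :=
  if h : ∃ F, IsFractionalIteration f F then h.choose else 0

/-- The fractional iterate `f^s`. -/
def iter (f : K⟦X⟧) (s : K) : K⟦X⟧ := atParam (fractionalIteration f) s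

/-- The iterative logarithm: the coefficientwise derivative of `f^s` with respect to `s`
at `s = 0`. -/
def itlog (f : K⟦X⟧) : K⟦X⟧ :=
  PowerSeries.mk fun n =>
    (Polynomial.derivative (PowerSeries.coeff n (fractionalIteration f))).eval 0

/-- `Q_* = itlog(Q̃)(D)`. -/
def star (Q : Op K) : Op K := seriesOp (itlog (indicator Q))

/-- Every polynomial is annihilated by some power of `U`, so that the series `∑ k, U ^ k / k!`
is a finite sum on each polynomial. -/
def IsLocallyNilpotent (U : Op K) : Prop :=
  ∀ p : K[X], ∃ k : ℕ, (U ^ k) p = 0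

/-- The exponential `∑ k, U ^ k / k!` of a locally nilpotent operator. -/
def opExp (U : Op K) : Op K :=
  (Polynomial.basisMonomials K).constr K fun n =>
    ∑ᶠ k : ℕ, (k.factorial : K)⁻¹ • (U ^ k) (Polynomial.X ^ n : K[X])

/-- The fractional power `φ^s = e^(-s x Q_*)` of the unitary umbral operator `φ` for `Q`. -/
def fracPow (Q : Op K) (s : K) : Op K := opExp (-(s • (mulX * star Q)))

end Field

section RCLike

variable {𝕜 : Type*} [RCLike 𝕜]

/-- `g` is the coefficientwise derivative at `s = 0` of the family `F` of iterates, i.e. the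
iterative logarithm belonging to `F`. -/
def IsItlog (F : 𝕜 → 𝕜⟦X⟧) (g : 𝕜⟦X⟧) : Prop :=
  ∀ n, HasDerivAt (fun s => PowerSeries.coeff n (F s)) (PowerSeries.coeff n g) 0

/-- `V = ∑ k, U ^ k / k!`, the series converging coefficientwise on every polynomial. -/
def HasOpExp (U V : Op 𝕜) : Prop :=
  ∀ (p : 𝕜[X]) (n : ℕ),
    HasSum (fun k : ℕ => ((k.factorial : 𝕜)⁻¹ • (U ^ k) p).coeff n) ((V p).coeff n)

end RCLike

end

end Umbral

/-! Everything is transposed to power series by the pairing ⟨p, h⟩ = (h(D) p)(0), which in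
characteristic zero separates polynomials, so that an operator is determined by its transpose
(`IsTranspose.eq`). Multiplication by x transposes to d/dt and g(D) to multiplication by g, so x
g(D) becomes the derivation L = g d/dt. With f the indicator of Q, the relations defining φ become
⟨φ p, h ∘ f⟩ = ⟨p, h⟩ (`IsUmbralFor.pair_subst`): the transpose of φ undoes composition with f. It
remains to see that h ↦ h ∘ f^(-1) is e^(-L) when g is the iterative logarithm of f.

Differentiating the group law at zero shows that s ↦ h ∘ f^s solves u' = L u with initial value h,
hence h ∘ f^s = e^(sL) h. The value s = -1 gives φ, and the other values give its fractional powers.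

If f = t + ⋯, the iterates come from the binomial series of (1 + N)^s with N h = h ∘ f - h
(`iterSeries`). Then t² divides g, L raises the order, and the exponential formula is Taylor's
formula for polynomials in s (`coeff_subst_iter`). In general L only preserves the order, so it acts
on truncated series, where the equation is a finite linear system solved by a matrix exponential
(`IsIteration.hasSum_coeff_subst`). -/

namespace Umbral

noncomputable section

section Field

variable {K : Type*} [Field K]

/-! ### Operators on power series that raise the order -/

/-- `A` raises the order of every power series by at least `d`. -/
def RaisesOrder (A : Module.End K K⟦X⟧) (d : ℕ) : Prop :=
  ∀ (m : ℕ) (h : K⟦X⟧), PowerSeries.X ^ m ∣ h → PowerSeries.X ^ (m + d) ∣ A h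

theorem RaisesOrder.pow {A : Module.End K K⟦X⟧} (hA : RaisesOrder A 1) (k : ℕ) :
    RaisesOrder (A ^ k) k := by
  induction k with
  | zero => intro m h hh; simpa using hh
  | succ k ih =>
    intro m h hh
    rw [pow_succ', Module.End.mul_apply, ← add_assoc]
    exact hA _ _ (ih _ _ hh)

theorem RaisesOrder.coeff_pow_apply_eq_zero {A : Module.End K K⟦X⟧} (hA : RaisesOrder A 1)
    (h : K⟦X⟧) {k n : ℕ} (hn : n < k) : PowerSeries.coeff n ((A ^ k) h) = 0 := by
  have := hA.pow k 0 h (by simp)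
  rw [zero_add] at this
  exact PowerSeries.X_pow_dvd_iff.1 this n hn

theorem X_pow_dvd_sub_sum (h : K⟦X⟧) (N : ℕ) :
    (PowerSeries.X : K⟦X⟧) ^ N ∣
      h - ∑ k ∈ Finset.range N, PowerSeries.coeff k h • (PowerSeries.X : K⟦X⟧) ^ k := by
  rw [PowerSeries.X_pow_dvd_iff]
  intro m hm
  simp [map_sum, PowerSeries.coeff_X_pow, hm]

/-- Plays the role of t-adic continuity: the tail of h of order N cannot reach the coefficient n <
N. -/
theorem RaisesOrder.coeff_eq_sum {A : Module.End K K⟦X⟧} (hA : RaisesOrder A 0) (h : K⟦X⟧)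
    {n N : ℕ} (hn : n < N) :
    PowerSeries.coeff n (A h) =
      ∑ k ∈ Finset.range N, PowerSeries.coeff k h * PowerSeries.coeff n (A (PowerSeries.X ^ k)) := by
  have := PowerSeries.X_pow_dvd_iff.1 (hA _ _ (X_pow_dvd_sub_sum h N)) n (by simpa using hn)
  rw [map_sub, map_sub, sub_eq_zero] at this
  simpa [map_sum] using this

/-! ### Composition of power series -/

/-- Right composition with `f`, as a linear operator. -/
def substL (f : K⟦X⟧) (hf : PowerSeries.constantCoeff f = 0) : Module.End K K⟦X⟧ :=
  (PowerSeries.substAlgHom (R := K) (PowerSeries.HasSubst.of_constantCoeff_zero' hf)).toLinearMap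

theorem substL_apply {f : K⟦X⟧} (hf : PowerSeries.constantCoeff f = 0) (h : K⟦X⟧) :
    substL f hf h = PowerSeries.subst f h := by
  rw [← PowerSeries.coe_substAlgHom (PowerSeries.HasSubst.of_constantCoeff_zero' hf)]
  rfl

theorem subst_X_pow' {f : K⟦X⟧} (hf : PowerSeries.constantCoeff f = 0) (k : ℕ) :
    PowerSeries.subst f (PowerSeries.X ^ k : K⟦X⟧) = f ^ k := by
  have hs := PowerSeries.HasSubst.of_constantCoeff_zero' hf
  rw [PowerSeries.subst_pow hs, PowerSeries.subst_X hs]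

theorem raisesOrder_substL {f : K⟦X⟧} (hf : PowerSeries.constantCoeff f = 0) :
    RaisesOrder (substL f hf) 0 := by
  rintro m _ ⟨q, rfl⟩
  rw [substL_apply, PowerSeries.subst_mul (PowerSeries.HasSubst.of_constantCoeff_zero' hf),
    subst_X_pow' hf]
  exact (pow_dvd_pow_of_dvd (PowerSeries.X_dvd_iff.2 hf) m).mul_right _

theorem coeff_subst_eq_sum {f : K⟦X⟧} (hf : PowerSeries.constantCoeff f = 0) (h : K⟦X⟧)
    {n N : ℕ} (hn : n < N) :
    PowerSeries.coeff n (PowerSeries.subst f h) =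
      ∑ k ∈ Finset.range N, PowerSeries.coeff k h * PowerSeries.coeff n (f ^ k) := by
  rw [← substL_apply hf, (raisesOrder_substL hf).coeff_eq_sum h hn]
  simp only [substL_apply, subst_X_pow' hf]

theorem constantCoeff_subst_of_zero {f : K⟦X⟧} (hf : PowerSeries.constantCoeff f = 0)
    (h : K⟦X⟧) :
    PowerSeries.constantCoeff (PowerSeries.subst f h) = PowerSeries.constantCoeff h := by
  have := coeff_subst_eq_sum hf h zero_lt_one
  rw [Finset.sum_range_one] at this
  simpa using this

theorem coeff_one_subst {f : K⟦X⟧} (hf : PowerSeries.constantCoeff f = 0) (h : K⟦X⟧) :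
    PowerSeries.coeff 1 (PowerSeries.subst f h) =
      PowerSeries.coeff 1 h * PowerSeries.coeff 1 f := by
  rw [coeff_subst_eq_sum hf h (N := 2) (by norm_num), Finset.sum_range_succ, Finset.sum_range_one]
  simp [PowerSeries.coeff_one]

theorem subst_subst {f g : K⟦X⟧} (hf : PowerSeries.constantCoeff f = 0)
    (hg : PowerSeries.constantCoeff g = 0) (h : K⟦X⟧) :
    PowerSeries.subst g (PowerSeries.subst f h) = PowerSeries.subst (PowerSeries.subst g f) h :=
  PowerSeries.subst_comp_subst_apply (PowerSeries.HasSubst.of_constantCoeff_zero' hf)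
    (PowerSeries.HasSubst.of_constantCoeff_zero' hg) h

theorem coeff_self_pow {f : K⟦X⟧} (hf : PowerSeries.constantCoeff f = 0) (n : ℕ) :
    PowerSeries.coeff n (f ^ n) = PowerSeries.coeff 1 f ^ n := by
  obtain ⟨w, rfl⟩ := PowerSeries.X_dvd_iff.2 hf
  have h1 := PowerSeries.coeff_X_pow_mul (w ^ n) n 0
  have h2 := PowerSeries.coeff_succ_X_mul 0 w
  rw [zero_add] at h1 h2
  rw [mul_pow, h1, h2]
  simp

/-! ### The derivation `g d/dt` -/

/-- The derivation `g d/dt` of power series. -/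
def mulDeriv (g : K⟦X⟧) : Module.End K K⟦X⟧ :=
  LinearMap.mulLeft K g ∘ₗ (PowerSeries.derivative K : K⟦X⟧ →ₗ[K] K⟦X⟧)

theorem mulDeriv_apply (g h : K⟦X⟧) : mulDeriv g h = g * PowerSeries.derivative K h := rfl

theorem raisesOrder_mulDeriv {g : K⟦X⟧} {d : ℕ} (hg : PowerSeries.X ^ (d + 1) ∣ g) :
    RaisesOrder (mulDeriv g) d := by
  rintro m h hh
  rw [mulDeriv_apply]
  cases m with
  | zero =>
    rw [zero_add]
    exact ((pow_dvd_pow _ d.le_succ).trans hg).mul_right _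
  | succ m =>
    rw [show m + 1 + d = (d + 1) + m by ring, pow_add]
    refine mul_dvd_mul hg ?_
    rw [PowerSeries.X_pow_dvd_iff] at hh ⊢
    intro k hk
    rw [PowerSeries.coeff_derivative, hh _ (by omega), zero_mul]

/-! ### The pairing of polynomials with power series -/

/-- The pairing `⟨p, h⟩ = ∑ k, k! p_k h_k = (h(D) p)(0)`. -/
def pair : K[X] →ₗ[K] K⟦X⟧ →ₗ[K] K :=
  (Polynomial.basisMonomials K).constr K fun k => (k.factorial : K) • PowerSeries.coeff k

theorem pair_monomial (n : ℕ) (a : K) (h : K⟦X⟧) :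
    pair (Polynomial.monomial n a) h = a * (n.factorial * PowerSeries.coeff n h) := by
  have : (Polynomial.monomial n a : K[X]) = a • Polynomial.basisMonomials K n := by
    simp [Polynomial.smul_monomial]
  rw [this, map_smul, pair, Module.Basis.constr_basis]
  simp

theorem pair_X_pow (n : ℕ) (h : K⟦X⟧) :
    pair (Polynomial.X ^ n : K[X]) h = n.factorial * PowerSeries.coeff n h := by
  rw [Polynomial.X_pow_eq_monomial, pair_monomial, one_mul]

theorem pair_eq_sum (p : K[X]) (h : K⟦X⟧) {N : ℕ} (hN : p.natDegree < N) :
    pair p h = ∑ k ∈ Finset.range N, p.coeff k * (k.factorial * PowerSeries.coeff k h) := by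
  conv_lhs => rw [p.as_sum_range' N hN]
  simp [map_sum, LinearMap.sum_apply, pair_monomial]

theorem pair_apply_X_pow (p : K[X]) (n : ℕ) :
    pair p (PowerSeries.X ^ n) = n.factorial * p.coeff n := by
  rw [pair_eq_sum p _ (N := p.natDegree + n + 1) (by omega),
    Finset.sum_eq_single n]
  · simp [PowerSeries.coeff_X_pow, mul_comm]
  · intro b _ hb; simp [PowerSeries.coeff_X_pow, hb]
  · intro hn; simp at hn

theorem pair_apply_C (p : K[X]) (a : K) : pair p (PowerSeries.C a) = p.eval 0 * a := by
  have : (PowerSeries.C a : K⟦X⟧) = a • PowerSeries.X ^ 0 := by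
    simp [PowerSeries.smul_eq_C_mul]
  rw [this, map_smul, pair_apply_X_pow, ← Polynomial.coeff_zero_eq_eval_zero]
  simp [mul_comm]

theorem pair_of_natDegree_le {p : K[X]} {h : K⟦X⟧} {d : ℕ} (hp : p.natDegree ≤ d)
    (hh : PowerSeries.X ^ d ∣ h) :
    pair p h = p.coeff d * (d.factorial * PowerSeries.coeff d h) := by
  rw [pair_eq_sum p h (Nat.lt_succ_of_le hp), Finset.sum_range_succ, Finset.sum_eq_zero, zero_add]
  intro k hk
  rw [PowerSeries.X_pow_dvd_iff.1 hh k (Finset.mem_range.1 hk), mul_zero, mul_zero]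

theorem pair_left_injective [CharZero K] {p q : K[X]} (H : ∀ h, pair p h = pair q h) : p = q := by
  ext n
  have := H (PowerSeries.X ^ n)
  rw [pair_apply_X_pow, pair_apply_X_pow] at this
  exact mul_left_cancel₀ (Nat.cast_ne_zero.2 n.factorial_ne_zero) this

/-- `B` is the transpose of `V` with respect to `pair`. -/
def IsTranspose (V : Op K) (B : Module.End K K⟦X⟧) : Prop :=
  ∀ p h, pair (V p) h = pair p (B h)

theorem IsTranspose.of_X_pow {V : Op K} {B : Module.End K K⟦X⟧}
    (H : ∀ (n : ℕ) (h : K⟦X⟧),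
      pair (V (Polynomial.X ^ n)) h = n.factorial * PowerSeries.coeff n (B h)) :
    IsTranspose V B := by
  intro p h
  induction p using Polynomial.induction_on' with
  | add p q hp hq => simp only [map_add, LinearMap.add_apply, hp, hq]
  | monomial n a =>
    rw [← Polynomial.C_mul_X_pow_eq_monomial, ← Polynomial.smul_eq_C_mul, map_smul, map_smul,
      map_smul, LinearMap.smul_apply, LinearMap.smul_apply, H, pair_X_pow]

theorem IsTranspose.eq [CharZero K] {V W : Op K} {B : Module.End K K⟦X⟧}
    (hV : IsTranspose V B) (hW : IsTranspose W B) : V = W := by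
  refine LinearMap.ext fun p => ?_
  exact pair_left_injective fun h => by rw [hV, hW]

theorem isTranspose_one : IsTranspose (1 : Op K) 1 := fun _ _ => rfl

theorem IsTranspose.mul {V W : Op K} {A B : Module.End K K⟦X⟧}
    (hV : IsTranspose V A) (hW : IsTranspose W B) : IsTranspose (V * W) (B * A) := by
  intro p h
  rw [Module.End.mul_apply, Module.End.mul_apply, hV, hW]

theorem IsTranspose.pow {V : Op K} {A : Module.End K K⟦X⟧} (hV : IsTranspose V A) (k : ℕ) :
    IsTranspose (V ^ k) (A ^ k) := by
  induction k with
  | zero => exact isTranspose_one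
  | succ k ih => rw [pow_succ, pow_succ']; exact ih.mul hV

/-- The weight k! in the pairing is what makes this work: (n + 1)! h_(n+1) = n! · (n + 1) h_(n+1).
-/
theorem isTranspose_mulX :
    IsTranspose (mulX : Op K) (PowerSeries.derivative K : K⟦X⟧ →ₗ[K] K⟦X⟧) := by
  refine IsTranspose.of_X_pow fun n h => ?_
  have : (mulX : Op K) (Polynomial.X ^ n) = Polynomial.X ^ (n + 1) := by
    rw [mulX, LinearMap.mulLeft_apply, pow_succ']
  rw [this, pair_X_pow, Derivation.coeFn_coe, PowerSeries.coeff_derivative, Nat.factorial_succ]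
  push_cast
  ring

theorem seriesOp_X_pow (g : K⟦X⟧) (n : ℕ) :
    seriesOp g (Polynomial.X ^ n) = ∑ k ∈ Finset.range (n + 1),
      PowerSeries.coeff k g • (D ^ k) (Polynomial.X ^ n : K[X]) := by
  conv_lhs => rw [Polynomial.X_pow_eq_monomial]
  have := (Polynomial.basisMonomials K).constr_basis K (fun n =>
    ∑ k ∈ Finset.range (n + 1), PowerSeries.coeff k g • (D ^ k) (Polynomial.X ^ n : K[X])) n
  rwa [Polynomial.coe_basisMonomials] at this

theorem D_pow_apply (k : ℕ) (p : K[X]) : (D ^ k) p = Polynomial.derivative^[k] p :=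
  Module.End.pow_apply _ _ _

theorem isTranspose_seriesOp (g : K⟦X⟧) : IsTranspose (seriesOp g) (LinearMap.mulLeft K g) := by
  refine IsTranspose.of_X_pow fun n h => ?_
  rw [seriesOp_X_pow, LinearMap.mulLeft_apply, PowerSeries.coeff_mul,
    Finset.Nat.sum_antidiagonal_eq_sum_range_succ
      (fun i j => PowerSeries.coeff i g * PowerSeries.coeff j h), Finset.mul_sum, map_sum,
    LinearMap.sum_apply]
  refine Finset.sum_congr rfl fun k hk => ?_
  have hk : k ≤ n := by simpa [Nat.lt_succ_iff] using hk
  rw [map_smul, LinearMap.smul_apply, D_pow_apply, Polynomial.iterate_derivative_X_pow_eq_smul,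
    map_smul, LinearMap.smul_apply, pair_X_pow, smul_eq_mul, smul_eq_mul,
    ← Nat.factorial_mul_descFactorial hk]
  push_cast
  ring

theorem isTranspose_mulX_mul_seriesOp (g : K⟦X⟧) :
    IsTranspose (mulX * seriesOp g) (mulDeriv g) :=
  isTranspose_mulX.mul (isTranspose_seriesOp g)

/-! ### Shift-invariant operators -/

theorem seriesOp_apply (g : K⟦X⟧) (p : K[X]) {N : ℕ} (hN : p.natDegree < N) :
    seriesOp g p = ∑ k ∈ Finset.range N, PowerSeries.coeff k g • (D ^ k) p := by
  have key : ∀ n < N, seriesOp g (Polynomial.X ^ n) =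
      (∑ k ∈ Finset.range N, PowerSeries.coeff k g • (D ^ k : Op K)) (Polynomial.X ^ n) := by
    intro n hn
    rw [seriesOp_X_pow, LinearMap.sum_apply]
    refine Finset.sum_subset (Finset.range_subset_range.2 hn) fun k _ hk => ?_
    have hk : n < k := by rw [Finset.mem_range] at hk; omega
    rw [D_pow_apply, Polynomial.iterate_derivative_eq_zero (by rwa [Polynomial.natDegree_X_pow]),
      smul_zero]
  have : seriesOp g p =
      (∑ k ∈ Finset.range N, PowerSeries.coeff k g • (D ^ k : Op K)) p := by
    rw [p.as_sum_range' N hN, map_sum, map_sum]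
    refine Finset.sum_congr rfl fun n hn => ?_
    rw [← Polynomial.C_mul_X_pow_eq_monomial, ← Polynomial.smul_eq_C_mul, map_smul, map_smul,
      key n (Finset.mem_range.1 hn)]
  rw [this, LinearMap.sum_apply]
  rfl

theorem D_pow_taylor (a : K) (k : ℕ) (p : K[X]) :
    (D ^ k) (Polynomial.taylor a p) = Polynomial.taylor a ((D ^ k) p) := by
  have h : Commute (D : Op K) (Polynomial.taylor a : Op K) := by
    refine LinearMap.ext fun p => ?_
    simp only [Module.End.mul_apply, D, Polynomial.taylor_apply, Polynomial.derivative_comp]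
    simp
  exact LinearMap.congr_fun (h.pow_left k) p

theorem isShiftInvariant_seriesOp (g : K⟦X⟧) : IsShiftInvariant (seriesOp g) := by
  intro a
  refine LinearMap.ext fun p => ?_
  rw [Module.End.mul_apply, Module.End.mul_apply,
    seriesOp_apply g _ (by rw [Polynomial.natDegree_taylor]; exact Nat.lt_succ_self p.natDegree),
    seriesOp_apply g p (Nat.lt_succ_self p.natDegree), map_sum]
  simp only [D_pow_taylor, map_smul]

/-- Shift-invariance gives (Q p)(a) = (Q p(x + a))(0); now expand p(x + a) in powers of x by
Taylor's formula. -/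
theorem seriesOp_indicator [CharZero K] {Q : Op K} (hQ : IsShiftInvariant Q) :
    seriesOp (indicator Q) = Q := by
  refine LinearMap.ext fun p => Polynomial.funext fun a => ?_
  have hN := Nat.lt_succ_self p.natDegree
  have h1 : (Q p).eval a = (Q (Polynomial.taylor a p)).eval 0 := by
    have := LinearMap.congr_fun (hQ a) p
    rw [Module.End.mul_apply, Module.End.mul_apply] at this
    rw [this, Polynomial.taylor_eval, zero_add]
  have h2 : (Polynomial.taylor a p).natDegree < p.natDegree.succ := by
    rw [Polynomial.natDegree_taylor]; exact hN
  rw [h1, seriesOp_apply _ p hN, (Polynomial.taylor a p).as_sum_range' _ h2, map_sum,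
    Polynomial.eval_finsetSum, Polynomial.eval_finsetSum]
  refine Finset.sum_congr rfl fun k _ => ?_
  have hk : (k.factorial : K) ≠ 0 := Nat.cast_ne_zero.2 k.factorial_ne_zero
  rw [← Polynomial.C_mul_X_pow_eq_monomial, ← Polynomial.smul_eq_C_mul, map_smul,
    Polynomial.eval_smul, Polynomial.eval_smul, Polynomial.taylor_coeff, D_pow_apply,
    ← Polynomial.factorial_smul_hasseDeriv, indicator, PowerSeries.coeff_mk, LinearMap.smul_apply,
    Polynomial.eval_smul, smul_eq_mul, smul_eq_mul, nsmul_eq_mul]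
  field_simp

theorem coeff_one_indicator (Q : Op K) {c : K} (hc : Q Polynomial.X = Polynomial.C c) :
    PowerSeries.coeff 1 (indicator Q) = c := by
  simp [indicator, hc]

/-! ### Umbral operators and composition -/

theorem IsUmbralFor.constantCoeff_indicator {φ Q : Op K} (h : IsUmbralFor φ Q) :
    PowerSeries.constantCoeff (indicator Q) = 0 := by
  have := h.sheffer 0
  rw [pow_zero, h.zeroth, Nat.cast_zero, zero_smul] at this
  rw [← PowerSeries.coeff_zero_eq_constantCoeff_apply, indicator, PowerSeries.coeff_mk, pow_zero,
    this]
  simp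

theorem IsUmbralFor.coeff_one_indicator_ne_zero {φ Q : Op K} (h : IsUmbralFor φ Q) :
    PowerSeries.coeff 1 (indicator Q) ≠ 0 := by
  obtain ⟨_, c, hc, hQ⟩ := h.delta
  rwa [coeff_one_indicator Q hQ]

/-- Induction on the exponent n of p = x^n. Write h = h(0) + t q, so h ∘ f = h(0) + f · (q ∘ f). For
n > 0 the constant pairs to zero because φ x^n vanishes at 0, and the factor f moves across the
pairing as Q, which lowers n. -/
theorem IsUmbralFor.pair_subst [CharZero K] {φ Q : Op K} (hφ : IsUmbralFor φ Q) (p : K[X])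
    (h : K⟦X⟧) : pair (φ p) (PowerSeries.subst (indicator Q) h) = pair p h := by
  have hs := PowerSeries.HasSubst.of_constantCoeff_zero' hφ.constantCoeff_indicator
  have hQ : IsTranspose Q (LinearMap.mulLeft K (indicator Q)) := by
    have := isTranspose_seriesOp (indicator Q)
    rwa [seriesOp_indicator hφ.delta.1] at this
  have key : ∀ n h, pair (φ (Polynomial.X ^ n)) (PowerSeries.subst (indicator Q) h) =
      n.factorial * PowerSeries.coeff n h := by
    intro n
    induction n with
    | zero =>
      intro h
      rw [pow_zero, hφ.zeroth, ← pow_zero Polynomial.X, pair_X_pow,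
        PowerSeries.coeff_zero_eq_constantCoeff_apply,
        constantCoeff_subst_of_zero hφ.constantCoeff_indicator,
        PowerSeries.coeff_zero_eq_constantCoeff_apply]
    | succ n ih =>
      intro h
      obtain ⟨q, hq⟩ := PowerSeries.X_dvd_iff.2
        (show PowerSeries.constantCoeff (h - PowerSeries.C (PowerSeries.constantCoeff h)) = 0 by simp)
      rw [sub_eq_iff_eq_add] at hq
      have hsub : PowerSeries.subst (indicator Q) h = indicator Q *
          PowerSeries.subst (indicator Q) q + PowerSeries.C (PowerSeries.constantCoeff h) := by
        conv_lhs => rw [hq]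
        rw [PowerSeries.subst_add hs, PowerSeries.subst_mul hs, PowerSeries.subst_X hs,
          PowerSeries.subst_C]
        rfl
      have h1 := hφ.sheffer (n + 1)
      have h2 := hQ (φ (Polynomial.X ^ (n + 1))) (PowerSeries.subst (indicator Q) q)
      rw [LinearMap.mulLeft_apply] at h2
      have h3 : PowerSeries.coeff (n + 1) h = PowerSeries.coeff n q := by
        rw [hq, map_add, PowerSeries.coeff_succ_X_mul, PowerSeries.coeff_C]
        simp
      rw [hsub, map_add, pair_apply_C, hφ.eval_zero _ n.succ_pos, zero_mul, add_zero, ← h2, h1,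
        Nat.add_sub_cancel, map_smul, LinearMap.smul_apply, ih, h3, Nat.factorial_succ, smul_eq_mul]
      push_cast
      ring
  induction p using Polynomial.induction_on' with
  | add p q hp hq => simp only [map_add, LinearMap.add_apply, hp, hq]
  | monomial n a =>
    rw [← Polynomial.C_mul_X_pow_eq_monomial, ← Polynomial.smul_eq_C_mul, map_smul, map_smul,
      map_smul, LinearMap.smul_apply, LinearMap.smul_apply, key, pair_X_pow]

/-- Test the pairing identity on h = t^d, where f^d = c^d t^d + ⋯ with c ≠ 0. Taking d to be the
degree of φ x^n bounds that degree by n; then d = n gives the identity. -/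
theorem IsUmbralFor.coeff_mul_pow [CharZero K] {φ Q : Op K} (hφ : IsUmbralFor φ Q) (n : ℕ) :
    (φ (Polynomial.X ^ n)).coeff n * PowerSeries.coeff 1 (indicator Q) ^ n = 1 := by
  have h0 := hφ.constantCoeff_indicator
  set f := indicator Q
  set q := φ (Polynomial.X ^ n)
  have hdvd : ∀ d, PowerSeries.X ^ d ∣ f ^ d := fun d =>
    pow_dvd_pow_of_dvd (PowerSeries.X_dvd_iff.2 h0) d
  have hp : ∀ d, pair q (f ^ d) = pair (Polynomial.X ^ n : K[X]) (PowerSeries.X ^ d) := fun d => by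
    rw [← subst_X_pow' h0]; exact hφ.pair_subst _ _
  have hdeg : q.natDegree ≤ n := by
    by_contra! hlt
    have h1 := hp q.natDegree
    rw [pair_of_natDegree_le le_rfl (hdvd _), coeff_self_pow h0, pair_X_pow,
      PowerSeries.coeff_X_pow, if_neg hlt.ne, mul_zero] at h1
    have hq : q ≠ 0 := by
      intro hq
      rw [hq] at hlt
      simp at hlt
    refine mul_ne_zero (Polynomial.leadingCoeff_ne_zero.2 hq) (mul_ne_zero ?_ ?_) h1
    · exact Nat.cast_ne_zero.2 (Nat.factorial_ne_zero _)
    · exact pow_ne_zero _ hφ.coeff_one_indicator_ne_zero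
  have h1 := hp n
  rw [pair_of_natDegree_le hdeg (hdvd n), coeff_self_pow h0, pair_X_pow, PowerSeries.coeff_X_pow,
    if_pos rfl, mul_left_comm] at h1
  exact mul_left_cancel₀ (Nat.cast_ne_zero.2 n.factorial_ne_zero) h1

theorem IsUmbralFor.isUnitaryOp_iff [CharZero K] {φ Q : Op K} (hφ : IsUmbralFor φ Q) :
    IsUnitaryOp φ ↔ IsUnitaryDelta Q := by
  obtain ⟨hQ, c, hc, hQX⟩ := hφ.delta
  have key := hφ.coeff_mul_pow
  rw [coeff_one_indicator Q hQX] at key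
  constructor
  · intro hu
    refine ⟨hQ, ?_⟩
    have := key 1
    rw [hu 1, one_mul, pow_one] at this
    rw [hQX, this, map_one]
  · rintro ⟨-, hX⟩ n
    have hc1 : c = 1 := by
      rw [hQX, ← Polynomial.C_1] at hX
      exact Polynomial.C_injective hX
    simpa [hc1] using key n

/-- Since f has a compositional inverse, every series is of the form h ∘ f, so identities between
polynomials may be tested against such series only. -/
theorem isUmbralFor_of_pair_subst [CharZero K] {φ : Op K} {f finv : K⟦X⟧}
    (hφ : IsUnit φ) (h0 : PowerSeries.constantCoeff f = 0) (h1 : PowerSeries.coeff 1 f ≠ 0)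
    (hi0 : PowerSeries.constantCoeff finv = 0) (hi : PowerSeries.subst f finv = PowerSeries.X)
    (H : ∀ p h, pair (φ p) (PowerSeries.subst f h) = pair p h) :
    IsUmbralFor φ (seriesOp f) := by
  have hs := PowerSeries.HasSubst.of_constantCoeff_zero' h0
  have hsurj : ∀ k : K⟦X⟧, ∃ h, k = PowerSeries.subst f h := fun k =>
    ⟨PowerSeries.subst finv k, by rw [subst_subst hi0 h0, hi, PowerSeries.X_subst]⟩
  refine ⟨⟨isShiftInvariant_seriesOp f, PowerSeries.coeff 1 f, h1, ?_⟩, hφ, ?_, ?_, ?_⟩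
  · have := seriesOp_X_pow f 1
    rw [pow_one, Finset.sum_range_succ, Finset.sum_range_one,
      PowerSeries.coeff_zero_eq_constantCoeff_apply, h0] at this
    rw [this]
    simp [D, Polynomial.smul_eq_C_mul]
  · intro n
    refine pair_left_injective fun k => ?_
    obtain ⟨h, rfl⟩ := hsurj k
    have : f * PowerSeries.subst f h = PowerSeries.subst f (PowerSeries.X * h) := by
      rw [PowerSeries.subst_mul hs, PowerSeries.subst_X hs]
    rw [isTranspose_seriesOp f, LinearMap.mulLeft_apply, this, H, map_smul, LinearMap.smul_apply, H,
      pair_X_pow, pair_X_pow]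
    cases n with
    | zero => simp
    | succ n =>
      rw [PowerSeries.coeff_succ_X_mul, Nat.add_sub_cancel, Nat.factorial_succ, smul_eq_mul]
      push_cast
      ring
  · refine pair_left_injective fun k => ?_
    obtain ⟨h, rfl⟩ := hsurj k
    rw [H, ← pow_zero Polynomial.X, pair_X_pow, pair_X_pow,
      PowerSeries.coeff_zero_eq_constantCoeff_apply,
      PowerSeries.coeff_zero_eq_constantCoeff_apply, constantCoeff_subst_of_zero h0]
  · intro n hn
    have := H (Polynomial.X ^ n) (PowerSeries.X ^ 0)
    rw [subst_X_pow' h0, pow_zero, ← pow_zero PowerSeries.X, pair_apply_X_pow, pair_X_pow,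
      PowerSeries.coeff_X_pow, if_neg hn.ne', mul_zero] at this
    rw [← Polynomial.coeff_zero_eq_eval_zero]
    simpa using this

/-! ### Differentiating one-parameter families of power series -/

/-- `T f a` expresses that `f` has derivative `a` at `0`, in a sense that obeys the rules for constants, sums
and products. -/
structure IsDerivRule (T : (K → K) → K → Prop) : Prop where
  const : ∀ a, T (fun _ => a) 0
  add : ∀ {f g a b}, T f a → T g b → T (fun r => f r + g r) (a + b)
  mul : ∀ {f g a b}, T f a → T g b → T (fun r => f r * g r) (f 0 * b + a * g 0)

theorem IsDerivRule.sum {T : (K → K) → K → Prop} (hT : IsDerivRule T) {ι : Type*} (s : Finset ι)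
    {f : ι → K → K} {a : ι → K} (H : ∀ i ∈ s, T (f i) (a i)) :
    T (fun r => ∑ i ∈ s, f i r) (∑ i ∈ s, a i) := by
  classical
  induction s using Finset.induction_on with
  | empty => simpa using hT.const 0
  | insert i s hi ih =>
    simp only [Finset.sum_insert hi]
    exact hT.add (H i (Finset.mem_insert_self i s))
      (ih fun j hj => H j (Finset.mem_insert_of_mem hj))

theorem IsDerivRule.coeff_pow {T : (K → K) → K → Prop} (hT : IsDerivRule T) {F : K → K⟦X⟧}
    {g : K⟦X⟧} (hF0 : F 0 = PowerSeries.X)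
    (hF : ∀ n, T (fun r => PowerSeries.coeff n (F r)) (PowerSeries.coeff n g)) (k n : ℕ) :
    T (fun r => PowerSeries.coeff n (F r ^ k))
      (PowerSeries.coeff n (mulDeriv g (PowerSeries.X ^ k))) := by
  induction k generalizing n with
  | zero =>
    simp only [pow_zero, mulDeriv_apply, Derivation.map_one_eq_zero, mul_zero, map_zero]
    exact hT.const _
  | succ k ih =>
    have h1 := hT.sum (Finset.HasAntidiagonal.antidiagonal n) (f := fun i r =>
      PowerSeries.coeff i.1 (F r ^ k) * PowerSeries.coeff i.2 (F r))
      fun i _ => hT.mul (ih i.1) (hF i.2)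
    simp only [← PowerSeries.coeff_mul, Finset.sum_add_distrib, hF0] at h1
    have h2 : mulDeriv g (PowerSeries.X ^ (k + 1)) =
        PowerSeries.X ^ k * g + mulDeriv g (PowerSeries.X ^ k) * PowerSeries.X := by
      simp only [mulDeriv_apply, pow_succ, Derivation.leibniz, PowerSeries.derivative_X,
        smul_eq_mul]
      ring
    rw [h2, map_add]
    simpa only [pow_succ] using h1

/-- The chain rule at the identity, serving both the formal derivative of polynomial functions and
the analytic derivative. Each coefficient is a finite combination of coefficients of powers of F r,
so sums and products suffice. -/
theorem IsDerivRule.coeff_subst {T : (K → K) → K → Prop} (hT : IsDerivRule T) {F : K → K⟦X⟧}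
    {g : K⟦X⟧} (hF0 : F 0 = PowerSeries.X) (hFc : ∀ s, PowerSeries.constantCoeff (F s) = 0)
    (hg : PowerSeries.constantCoeff g = 0)
    (hF : ∀ n, T (fun r => PowerSeries.coeff n (F r)) (PowerSeries.coeff n g)) (h : K⟦X⟧) (n : ℕ) :
    T (fun r => PowerSeries.coeff n (PowerSeries.subst (F r) h))
      (PowerSeries.coeff n (mulDeriv g h)) := by
  have hg' : RaisesOrder (mulDeriv g) 0 :=
    raisesOrder_mulDeriv (by simpa using PowerSeries.X_dvd_iff.2 hg)
  have h1 := hT.sum (Finset.range (n + 1)) fun k _ =>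
    hT.mul (hT.const (PowerSeries.coeff k h)) (hT.coeff_pow hF0 hF k n)
  simp only [zero_mul, add_zero, ← hg'.coeff_eq_sum h n.lt_succ_self] at h1
  simpa only [coeff_subst_eq_sum (hFc _) h n.lt_succ_self] using h1

/-! ### One-parameter groups of power series -/

/-- The group law gives F 0 ∘ f = f, and f can be cancelled since its linear coefficient is
invertible. -/
theorem IsIteration.zero {f : K⟦X⟧} {F : K → K⟦X⟧} (hF : IsIteration f F)
    (h1 : PowerSeries.coeff 1 f ≠ 0) : F 0 = PowerSeries.X := by
  have h0 : PowerSeries.constantCoeff f = 0 := hF.one ▸ hF.constantCoeff 1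
  have hu : IsUnit (PowerSeries.coeff 1 f) := h1.isUnit
  have hi0 := PowerSeries.constantCoeff_substInvOfIsUnit f hu
  have hi := PowerSeries.subst_substInvOfIsUnit_right f h0 hu
  have := hF.comp 0 1
  rw [zero_add, hF.one] at this
  have := congrArg (PowerSeries.subst (f.substInvOfIsUnit hu)) this
  rwa [subst_subst h0 hi0, hi, PowerSeries.X_subst] at this

theorem IsIteration.subst_subst_apply {f : K⟦X⟧} {F : K → K⟦X⟧} (hF : IsIteration f F) (r s : K)
    (h : K⟦X⟧) :
    PowerSeries.subst (F s) (PowerSeries.subst (F r) h) = PowerSeries.subst (F (r + s)) h := by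
  rw [subst_subst (hF.constantCoeff r) (hF.constantCoeff s), hF.comp]

theorem IsIteration.subst_neg_subst {f : K⟦X⟧} {F : K → K⟦X⟧} (hF : IsIteration f F)
    (h1 : PowerSeries.coeff 1 f ≠ 0) (s : K) (h : K⟦X⟧) :
    PowerSeries.subst (F (-s)) (PowerSeries.subst (F s) h) = h := by
  rw [hF.subst_subst_apply, add_neg_cancel, hF.zero h1, PowerSeries.X_subst]

/-! ### Existence and uniqueness of the fractional iteration -/

theorem coeff_atParam (F : PowerSeries K[X]) (s : K) (n : ℕ) :
    PowerSeries.coeff n (atParam F s) = (PowerSeries.coeff n F).eval s := by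
  rw [atParam, PowerSeries.coeff_map, Polynomial.coe_evalRingHom]

theorem coeff_atParam_pow (F : PowerSeries K[X]) (s : K) (n k : ℕ) :
    PowerSeries.coeff n (atParam F s ^ k) = (PowerSeries.coeff n (F ^ k)).eval s := by
  rw [atParam, ← map_pow, PowerSeries.coeff_map, Polynomial.coe_evalRingHom]

theorem polynomial_eq_of_eval_natCast [CharZero K] {P Q : K[X]}
    (H : ∀ m : ℕ, P.eval (m : K) = Q.eval (m : K)) : P = Q :=
  Polynomial.eq_of_infinite_eval_eq P Q
    (Set.infinite_of_injective_forall_mem (Nat.cast_injective (R := K)) H)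

/-- With f = t w and w(0) = 1, for h = t^m q the difference h ∘ f - h is t^m times (w^m - 1)(q ∘ f)
+ (q ∘ f - q), and t divides both terms. -/
theorem raisesOrder_substL_sub_one {f : K⟦X⟧} (h0 : PowerSeries.constantCoeff f = 0)
    (h1 : PowerSeries.coeff 1 f = 1) : RaisesOrder (substL f h0 - 1) 1 := by
  rintro m _ ⟨q, rfl⟩
  obtain ⟨w, hw⟩ := PowerSeries.X_dvd_iff.2 h0
  have hw1 : PowerSeries.X ∣ w ^ m - 1 := by
    refine dvd_trans ?_ (sub_one_dvd_pow_sub_one w m)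
    rw [PowerSeries.X_dvd_iff, map_sub, map_one, sub_eq_zero, ← h1, hw]
    simp
  have hq : PowerSeries.X ∣ PowerSeries.subst f q - q := by
    rw [PowerSeries.X_dvd_iff, map_sub, constantCoeff_subst_of_zero h0, sub_self]
  have hfm : f ^ m = PowerSeries.X ^ m * w ^ m := by rw [hw, mul_pow]
  rw [LinearMap.sub_apply, substL_apply, Module.End.one_apply,
    PowerSeries.subst_mul (PowerSeries.HasSubst.of_constantCoeff_zero' h0), subst_X_pow' h0, hfm,
    show PowerSeries.X ^ m * w ^ m * PowerSeries.subst f q - PowerSeries.X ^ m * q =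
      PowerSeries.X ^ m * ((w ^ m - 1) * PowerSeries.subst f q + (PowerSeries.subst f q - q)) by ring,
    pow_succ]
  exact mul_dvd_mul_left _ (dvd_add (hw1.mul_right _) hq)

/-- The binomial coefficient `s ↦ s (s - 1) ⋯ (s - j + 1) / j!` as a polynomial. -/
def binomPoly (K : Type*) [Field K] (j : ℕ) : K[X] :=
  Polynomial.C (j.factorial : K)⁻¹ * descPochhammer K j

theorem eval_binomPoly_natCast [CharZero K] (j m : ℕ) :
    (binomPoly K j).eval (m : K) = m.choose j := by
  have hj : (j.factorial : K) ≠ 0 := Nat.cast_ne_zero.2 j.factorial_ne_zero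
  rw [binomPoly, Polynomial.eval_mul, Polynomial.eval_C, descPochhammer_eval_eq_descFactorial,
    Nat.descFactorial_eq_factorial_mul_choose, Nat.cast_mul, inv_mul_cancel_left₀ hj]

/-- The series `∑ j, binom(s, j) N ^ j t`, where `N h = h ∘ f - h`. -/
def iterSeries (f : K⟦X⟧) (h0 : PowerSeries.constantCoeff f = 0) : PowerSeries K[X] :=
  PowerSeries.mk fun n => ∑ j ∈ Finset.range (n + 1),
    Polynomial.C (PowerSeries.coeff n (((substL f h0 - 1) ^ j) PowerSeries.X)) * binomPoly K j

theorem atParam_iterSeries_natCast [CharZero K] {f : K⟦X⟧} (h0 : PowerSeries.constantCoeff f = 0)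
    (h1 : PowerSeries.coeff 1 f = 1) (m : ℕ) :
    atParam (iterSeries f h0) (m : K) = (substL f h0 ^ m) PowerSeries.X := by
  ext n
  have hN := raisesOrder_substL_sub_one h0 h1
  set N := substL f h0 - 1 with hNdef
  have hA : substL f h0 = N + 1 := by rw [hNdef, sub_add_cancel]
  rw [coeff_atParam, iterSeries, PowerSeries.coeff_mk, ← hNdef, hA,
    (Commute.one_right N).add_pow, LinearMap.sum_apply, map_sum, Polynomial.eval_finsetSum]
  simp only [one_pow, mul_one, Polynomial.eval_mul, Polynomial.eval_C, eval_binomPoly_natCast]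
  have hr : ∀ j, PowerSeries.coeff n ((N ^ j * (m.choose j : Module.End K K⟦X⟧)) PowerSeries.X) =
      PowerSeries.coeff n ((N ^ j) PowerSeries.X) * (m.choose j : K) := by
    intro j
    rw [← nsmul_eq_mul', LinearMap.smul_apply, map_nsmul, nsmul_eq_mul, mul_comm]
  -- The two sums have different ranges: terms with j > n vanish because N raises the order, those
  -- with j > m because binom(m, j) = 0.
  simp only [hr]
  trans ∑ j ∈ Finset.range (n + m + 1),
    PowerSeries.coeff n ((N ^ j) PowerSeries.X) * (m.choose j : K)
  · refine Finset.sum_subset (Finset.range_subset_range.2 (by omega)) fun j _ hj => ?_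
    rw [hN.coeff_pow_apply_eq_zero _ (by rw [Finset.mem_range] at hj; omega), zero_mul]
  · refine (Finset.sum_subset (Finset.range_subset_range.2 (by omega)) fun j _ hj => ?_).symm
    rw [Nat.choose_eq_zero_of_lt (by rw [Finset.mem_range] at hj; omega), Nat.cast_zero, mul_zero]

theorem subst_pow_substL_X {f : K⟦X⟧} (h0 : PowerSeries.constantCoeff f = 0) (k : ℕ) :
    PowerSeries.constantCoeff ((substL f h0 ^ k) PowerSeries.X) = 0 ∧
    ∀ h, PowerSeries.subst ((substL f h0 ^ k) PowerSeries.X) h = (substL f h0 ^ k) h := by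
  induction k with
  | zero => simp [PowerSeries.X_subst]
  | succ k ih =>
    simp only [pow_succ', Module.End.mul_apply, substL_apply]
    refine ⟨by rw [constantCoeff_subst_of_zero h0, ih.1], fun h => ?_⟩
    rw [← subst_subst ih.1 h0, ih.2]

/-- The group law holds for natural exponents. Both sides are coefficientwise polynomial in each
exponent, so it extends to all of K first in r, then in s. -/
theorem isFractionalIteration_iterSeries [CharZero K] {f : K⟦X⟧}
    (h0 : PowerSeries.constantCoeff f = 0) (h1 : PowerSeries.coeff 1 f = 1) :
    IsFractionalIteration f (iterSeries f h0) := by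
  have hnat := atParam_iterSeries_natCast h0 h1
  set F := iterSeries f h0 with hF
  have hc : ∀ s, PowerSeries.constantCoeff (atParam F s) = 0 := by
    intro s
    rw [← PowerSeries.coeff_zero_eq_constantCoeff_apply, coeff_atParam, hF, iterSeries,
      PowerSeries.coeff_mk]
    simp
  have hnn : ∀ m k : ℕ, PowerSeries.subst (atParam F k) (atParam F m) = atParam F (m + k) := by
    intro m k
    rw [← Nat.cast_add, hnat, hnat, hnat, (subst_pow_substL_X h0 k).2, ← Module.End.mul_apply,
      ← pow_add, add_comm]
  have hrn : ∀ (r : K) (k : ℕ),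
      PowerSeries.subst (atParam F k) (atParam F r) = atParam F (r + k) := by
    intro r k
    ext n
    have hpoly : (∑ j ∈ Finset.range (n + 1), PowerSeries.coeff j F *
        Polynomial.C (PowerSeries.coeff n (atParam F k ^ j))) =
        (PowerSeries.coeff n F).comp (Polynomial.X + Polynomial.C (k : K)) := by
      refine polynomial_eq_of_eval_natCast fun m => ?_
      have := congrArg (PowerSeries.coeff n) (hnn m k)
      rw [coeff_subst_eq_sum (hc _) _ n.lt_succ_self, coeff_atParam] at this
      simpa [Polynomial.eval_finsetSum, coeff_atParam] using this
    have := congrArg (Polynomial.eval r) hpoly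
    rw [coeff_subst_eq_sum (hc _) _ n.lt_succ_self, coeff_atParam]
    simpa [Polynomial.eval_finsetSum, coeff_atParam] using this
  refine ⟨hc, ?_, fun r s => ?_⟩
  · rw [← Nat.cast_one, hnat, pow_one, substL_apply,
      PowerSeries.subst_X (PowerSeries.HasSubst.of_constantCoeff_zero' h0)]
  · ext n
    have hpoly : (∑ j ∈ Finset.range (n + 1), Polynomial.C (PowerSeries.coeff j (atParam F r)) *
        PowerSeries.coeff n (F ^ j)) =
        (PowerSeries.coeff n F).comp (Polynomial.C r + Polynomial.X) := by
      refine polynomial_eq_of_eval_natCast fun k => ?_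
      have := congrArg (PowerSeries.coeff n) (hrn r k)
      rw [coeff_subst_eq_sum (hc _) _ n.lt_succ_self, coeff_atParam] at this
      simpa [Polynomial.eval_finsetSum, coeff_atParam_pow] using this
    have := congrArg (Polynomial.eval s) hpoly
    rw [coeff_subst_eq_sum (hc _) _ n.lt_succ_self, coeff_atParam]
    simpa [Polynomial.eval_finsetSum, coeff_atParam_pow] using this

theorem IsFractionalIteration.atParam_natCast {f : K⟦X⟧} {F : PowerSeries K[X]}
    (hF : IsFractionalIteration f F) (h0 : PowerSeries.constantCoeff f = 0)
    (h1 : PowerSeries.coeff 1 f = 1) (m : ℕ) :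
    atParam F (m : K) = (substL f h0 ^ m) PowerSeries.X := by
  induction m with
  | zero =>
    rw [Nat.cast_zero, IsIteration.zero hF (by rw [h1]; exact one_ne_zero)]
    rfl
  | succ m ih =>
    rw [Nat.cast_succ, ← hF.comp, ih, hF.one, pow_succ', Module.End.mul_apply, substL_apply]

/-- Uniqueness: the group law forces the values at natural exponents, and these determine
polynomials. -/
theorem existsUnique_isFractionalIteration [CharZero K] {f : K⟦X⟧}
    (h0 : PowerSeries.constantCoeff f = 0) (h1 : PowerSeries.coeff 1 f = 1) :
    ∃! F, IsFractionalIteration f F := by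
  refine ⟨_, isFractionalIteration_iterSeries h0 h1, fun F hF => ?_⟩
  ext1 n
  refine polynomial_eq_of_eval_natCast fun m => ?_
  rw [← coeff_atParam, ← coeff_atParam, hF.atParam_natCast h0 h1,
    atParam_iterSeries_natCast h0 h1]

theorem isFractionalIteration_fractionalIteration [CharZero K] {f : K⟦X⟧}
    (h0 : PowerSeries.constantCoeff f = 0) (h1 : PowerSeries.coeff 1 f = 1) :
    IsFractionalIteration f (fractionalIteration f) := by
  have h := (existsUnique_isFractionalIteration h0 h1).exists
  rw [fractionalIteration, dif_pos h]
  exact h.choose_spec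

theorem isIteration_iter [CharZero K] {f : K⟦X⟧}
    (h0 : PowerSeries.constantCoeff f = 0) (h1 : PowerSeries.coeff 1 f = 1) :
    IsIteration f (iter f) :=
  isFractionalIteration_fractionalIteration h0 h1

/-! ### The Lie series of the fractional iteration -/

theorem coeff_one_fractionalIteration [CharZero K] {f : K⟦X⟧}
    (h0 : PowerSeries.constantCoeff f = 0) (h1 : PowerSeries.coeff 1 f = 1) :
    PowerSeries.coeff 1 (fractionalIteration f) = 1 := by
  have hF := isFractionalIteration_fractionalIteration h0 h1
  refine polynomial_eq_of_eval_natCast fun m => ?_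
  rw [← coeff_atParam, Polynomial.eval_one]
  induction m with
  | zero =>
    rw [Nat.cast_zero, IsIteration.zero hF (by rw [h1]; exact one_ne_zero),
      PowerSeries.coeff_one_X]
  | succ m ih =>
    rw [Nat.cast_succ, ← hF.comp, coeff_one_subst (hF.constantCoeff 1), ih, hF.one, h1, one_mul]

theorem coeff_zero_fractionalIteration [CharZero K] {f : K⟦X⟧}
    (h0 : PowerSeries.constantCoeff f = 0) (h1 : PowerSeries.coeff 1 f = 1) :
    PowerSeries.coeff 0 (fractionalIteration f) = 0 := by
  refine Polynomial.funext fun s => ?_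
  rw [← coeff_atParam, PowerSeries.coeff_zero_eq_constantCoeff_apply,
    (isFractionalIteration_fractionalIteration h0 h1).constantCoeff, Polynomial.eval_zero]

theorem X_sq_dvd_itlog [CharZero K] {f : K⟦X⟧} (h0 : PowerSeries.constantCoeff f = 0)
    (h1 : PowerSeries.coeff 1 f = 1) : PowerSeries.X ^ 2 ∣ itlog f := by
  rw [PowerSeries.X_pow_dvd_iff]
  intro m hm
  rw [itlog, PowerSeries.coeff_mk]
  interval_cases m
  · rw [coeff_zero_fractionalIteration h0 h1]; simp
  · rw [coeff_one_fractionalIteration h0 h1]; simp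

theorem isDerivRule_polynomial : IsDerivRule fun (f : K → K) a =>
    ∃ P : K[X], (∀ s, f s = P.eval s) ∧ a = (Polynomial.derivative P).eval 0 where
  const a := ⟨Polynomial.C a, by simp, by simp⟩
  add := by
    rintro f g _ _ ⟨P, hP, rfl⟩ ⟨R, hR, rfl⟩
    exact ⟨P + R, fun s => by simp only [hP, hR, Polynomial.eval_add],
      by rw [Polynomial.derivative_add, Polynomial.eval_add]⟩
  mul := by
    rintro f g _ _ ⟨P, hP, rfl⟩ ⟨R, hR, rfl⟩
    refine ⟨P * R, fun s => by simp only [hP, hR, Polynomial.eval_mul], ?_⟩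
    rw [Polynomial.derivative_mul, Polynomial.eval_add, Polynomial.eval_mul, Polynomial.eval_mul,
      hP, hR, add_comm]

/-- The `n`-th coefficient of `h ∘ F_s` as a polynomial in `s`. -/
def substCoeff (F : PowerSeries K[X]) (h : K⟦X⟧) (n : ℕ) : K[X] :=
  ∑ k ∈ Finset.range (n + 1), Polynomial.C (PowerSeries.coeff k h) * PowerSeries.coeff n (F ^ k)

theorem eval_substCoeff {F : PowerSeries K[X]} {s : K}
    (hF : PowerSeries.constantCoeff (atParam F s) = 0) (h : K⟦X⟧) (n : ℕ) :
    (substCoeff F h n).eval s = PowerSeries.coeff n (PowerSeries.subst (atParam F s) h) := by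
  rw [coeff_subst_eq_sum hF h n.lt_succ_self]
  simp [substCoeff, Polynomial.eval_finsetSum, coeff_atParam_pow]

/-- Differentiate h ∘ f^(r+s) = (h ∘ f^r) ∘ f^s in r at r = 0, with s fixed. -/
theorem derivative_substCoeff [CharZero K] {f : K⟦X⟧} (h0 : PowerSeries.constantCoeff f = 0)
    (h1 : PowerSeries.coeff 1 f = 1) (h : K⟦X⟧) (n : ℕ) :
    Polynomial.derivative (substCoeff (fractionalIteration f) h n) =
      substCoeff (fractionalIteration f) (mulDeriv (itlog f) h) n := by
  have hF := isFractionalIteration_fractionalIteration h0 h1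
  set F := fractionalIteration f with hFdef
  refine Polynomial.funext fun s => ?_
  have hT := isDerivRule_polynomial (K := K)
  have hF0 : atParam F 0 = PowerSeries.X := IsIteration.zero hF (by rw [h1]; exact one_ne_zero)
  have hg : PowerSeries.constantCoeff (itlog f) = 0 :=
    PowerSeries.X_dvd_iff.1 ((dvd_pow_self _ two_ne_zero).trans (X_sq_dvd_itlog h0 h1))
  have hsub := hT.coeff_subst (F := atParam F) (g := itlog f) hF0 hF.constantCoeff hg
    (fun n => ⟨PowerSeries.coeff n F, fun s => coeff_atParam F s n, by
      rw [itlog, PowerSeries.coeff_mk]⟩) h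
  -- P is the n-th coefficient of (h ∘ f^r) ∘ f^s as a polynomial in r.
  obtain ⟨P, hP, hP'⟩ := hT.sum (Finset.range (n + 1)) fun k _ =>
    hT.mul (hsub k) (hT.const (PowerSeries.coeff n (atParam F s ^ k)))
  have hcomp : (substCoeff F h n).comp (Polynomial.X + Polynomial.C s) = P := by
    refine Polynomial.funext fun r => ?_
    have hPr := hP r
    simp only at hPr
    rw [← hPr, ← coeff_subst_eq_sum (hF.constantCoeff s) _ n.lt_succ_self,
      IsIteration.subst_subst_apply hF, Polynomial.eval_comp,
      ← eval_substCoeff (hF.constantCoeff (r + s))]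
    simp
  simp only [mul_zero, zero_add, ← coeff_subst_eq_sum (hF.constantCoeff s) _ n.lt_succ_self] at hP'
  rw [eval_substCoeff (hF.constantCoeff s), hP', ← hcomp, Polynomial.derivative_comp]
  simp

/-- Taylor's formula at s = 0: the k-th derivative there is the n-th coefficient of L^k h, which
vanishes for k > n because L raises the order. -/
theorem coeff_subst_iter [CharZero K] {f : K⟦X⟧} (h0 : PowerSeries.constantCoeff f = 0)
    (h1 : PowerSeries.coeff 1 f = 1) (s : K) (h : K⟦X⟧) (n : ℕ) :
    PowerSeries.coeff n (PowerSeries.subst (iter f s) h) =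
      ∑ k ∈ Finset.range (n + 1), ((k.factorial : K)⁻¹ *
        PowerSeries.coeff n ((mulDeriv (itlog f) ^ k) h)) * s ^ k := by
  have hF := isFractionalIteration_fractionalIteration h0 h1
  have hL : RaisesOrder (mulDeriv (itlog f)) 1 := raisesOrder_mulDeriv (X_sq_dvd_itlog h0 h1)
  have hiter : ∀ k h, Polynomial.derivative^[k] (substCoeff (fractionalIteration f) h n) =
      substCoeff (fractionalIteration f) ((mulDeriv (itlog f) ^ k) h) n := by
    intro k
    induction k with
    | zero => intro h; rfl
    | succ k ih =>
      intro h
      rw [Function.iterate_succ_apply, derivative_substCoeff h0 h1, ih, pow_succ,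
        Module.End.mul_apply]
  have hcoeff : ∀ k, (substCoeff (fractionalIteration f) h n).coeff k =
      (k.factorial : K)⁻¹ * PowerSeries.coeff n ((mulDeriv (itlog f) ^ k) h) := by
    intro k
    have h2 := congrArg (Polynomial.eval 0) (hiter k h)
    rw [eval_substCoeff (hF.constantCoeff 0), IsIteration.zero hF (by rw [h1]; exact one_ne_zero),
      PowerSeries.X_subst, ← Polynomial.coeff_zero_eq_eval_zero,
      Polynomial.coeff_iterate_derivative, zero_add, Nat.descFactorial_self, nsmul_eq_mul] at h2
    rw [← h2, inv_mul_cancel_left₀ (Nat.cast_ne_zero.2 k.factorial_ne_zero)]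
  have hdeg : (substCoeff (fractionalIteration f) h n).natDegree < n + 1 := by
    rw [Nat.lt_succ_iff, Polynomial.natDegree_le_iff_coeff_eq_zero]
    intro k hk
    rw [hcoeff, hL.coeff_pow_apply_eq_zero _ hk, mul_zero]
  rw [iter, ← eval_substCoeff (hF.constantCoeff s), Polynomial.eval_eq_sum_range' hdeg]
  simp only [hcoeff]

/-! ### Exponentials of locally nilpotent operators -/

theorem IsTranspose.pow_apply_eq_zero [CharZero K] {U : Op K} {A : Module.End K K⟦X⟧}
    (hU : IsTranspose U A) (hA : RaisesOrder A 1) {p : K[X]} {k : ℕ} (hk : p.natDegree < k) :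
    (U ^ k) p = 0 := by
  refine pair_left_injective fun h => ?_
  rw [hU.pow k, pair_eq_sum p _ p.natDegree.lt_succ_self, map_zero, LinearMap.zero_apply]
  refine Finset.sum_eq_zero fun j hj => ?_
  rw [hA.coeff_pow_apply_eq_zero _ (by rw [Finset.mem_range] at hj; omega), mul_zero, mul_zero]

theorem neg_smul_pow (s : K) (U : Op K) (k : ℕ) : (-(s • U)) ^ k = (-s) ^ k • U ^ k := by
  have : -(s • U) = (-s) • U := (neg_smul s U).symm
  rw [this, smul_pow]

theorem opExp_X_pow {V : Op K} {n : ℕ} (hV : ∀ k, n < k → (V ^ k) (Polynomial.X ^ n) = 0) :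
    opExp V (Polynomial.X ^ n) = ∑ k ∈ Finset.range (n + 1),
      (k.factorial : K)⁻¹ • (V ^ k) (Polynomial.X ^ n : K[X]) := by
  have := (Polynomial.basisMonomials K).constr_basis K (fun n =>
    ∑ᶠ k : ℕ, (k.factorial : K)⁻¹ • (V ^ k) (Polynomial.X ^ n : K[X])) n
  simp only [Polynomial.coe_basisMonomials, ← Polynomial.X_pow_eq_monomial] at this
  rw [opExp, this]
  refine finsum_eq_sum_of_support_subset _ fun k hk => ?_
  rw [Finset.coe_range, Set.mem_Iio]
  by_contra hlt
  exact hk (by simp only [hV k (by omega), smul_zero])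

theorem isTranspose_opExp [CharZero K] {f : K⟦X⟧} (h0 : PowerSeries.constantCoeff f = 0)
    (h1 : PowerSeries.coeff 1 f = 1) (s : K) :
    IsTranspose (opExp (-(s • (mulX * seriesOp (itlog f)))))
      (substL (iter f (-s)) ((isIteration_iter h0 h1).constantCoeff _)) := by
  have hL : RaisesOrder (mulDeriv (itlog f)) 1 := raisesOrder_mulDeriv (X_sq_dvd_itlog h0 h1)
  have hU := isTranspose_mulX_mul_seriesOp (itlog f)
  refine IsTranspose.of_X_pow fun n h => ?_
  have hpow := neg_smul_pow s (mulX * seriesOp (itlog f))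
  rw [opExp_X_pow fun k hk => by
    rw [hpow, LinearMap.smul_apply, hU.pow_apply_eq_zero hL (by simpa using hk), smul_zero],
    map_sum, LinearMap.sum_apply, substL_apply, coeff_subst_iter h0 h1, Finset.mul_sum]
  refine Finset.sum_congr rfl fun k _ => ?_
  rw [hpow, LinearMap.smul_apply, map_smul, map_smul, LinearMap.smul_apply, LinearMap.smul_apply,
    hU.pow k, pair_X_pow, smul_eq_mul, smul_eq_mul]
  ring

theorem isTranspose_fracPow [CharZero K] {Q : Op K}
    (h0 : PowerSeries.constantCoeff (indicator Q) = 0)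
    (h1 : PowerSeries.coeff 1 (indicator Q) = 1) (s : K) :
    IsTranspose (fracPow Q s) (substL (iter (indicator Q) (-s))
      ((isIteration_iter h0 h1).constantCoeff _)) :=
  isTranspose_opExp h0 h1 s

theorem fracPow_add [CharZero K] {Q : Op K} (h0 : PowerSeries.constantCoeff (indicator Q) = 0)
    (h1 : PowerSeries.coeff 1 (indicator Q) = 1) (r s : K) :
    fracPow Q (r + s) = fracPow Q r * fracPow Q s := by
  have hF := isIteration_iter h0 h1
  refine (isTranspose_fracPow h0 h1 (r + s)).eq ?_
  convert (isTranspose_fracPow h0 h1 r).mul (isTranspose_fracPow h0 h1 s) using 1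
  refine LinearMap.ext fun h => ?_
  rw [Module.End.mul_apply, substL_apply, substL_apply, substL_apply]
  rw [hF.subst_subst_apply, neg_add]

theorem fracPow_zero [CharZero K] {Q : Op K} (h0 : PowerSeries.constantCoeff (indicator Q) = 0)
    (h1 : PowerSeries.coeff 1 (indicator Q) = 1) : fracPow Q 0 = 1 := by
  have hF := isIteration_iter h0 h1
  refine (isTranspose_fracPow h0 h1 0).eq ?_
  convert isTranspose_one using 1
  refine LinearMap.ext fun h => ?_
  rw [substL_apply, neg_zero, hF.zero (by rw [h1]; exact one_ne_zero),
    PowerSeries.X_subst, Module.End.one_apply]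

theorem isUnit_fracPow [CharZero K] {Q : Op K} (h0 : PowerSeries.constantCoeff (indicator Q) = 0)
    (h1 : PowerSeries.coeff 1 (indicator Q) = 1) (s : K) : IsUnit (fracPow Q s) :=
  ⟨⟨fracPow Q s, fracPow Q (-s), by rw [← fracPow_add h0 h1, add_neg_cancel, fracPow_zero h0 h1],
    by rw [← fracPow_add h0 h1, neg_add_cancel, fracPow_zero h0 h1]⟩, rfl⟩

/-- Both operators have composition with f^(-1) as transpose. -/
theorem IsUmbralFor.eq_fracPow_one [CharZero K] {φ Q : Op K} (hφ : IsUmbralFor φ Q)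
    (h1 : PowerSeries.coeff 1 (indicator Q) = 1) : φ = fracPow Q 1 := by
  have h0 := hφ.constantCoeff_indicator
  have hF := isIteration_iter h0 h1
  refine IsTranspose.eq (fun p h => ?_) (isTranspose_fracPow h0 h1 1)
  have h2 := hF.subst_neg_subst (by rw [h1]; exact one_ne_zero) (-1) h
  rw [neg_neg, hF.one] at h2
  rw [substL_apply, ← hφ.pair_subst p, h2]

theorem fracPow_intCast [CharZero K] {Q : Op K} (h0 : PowerSeries.constantCoeff (indicator Q) = 0)
    (h1 : PowerSeries.coeff 1 (indicator Q) = 1) (u : (Op K)ˣ) (hu : (u : Op K) = fracPow Q 1)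
    (n : ℤ) : fracPow Q (n : K) = ((u ^ n : (Op K)ˣ) : Op K) := by
  have hinv : ((u⁻¹ : (Op K)ˣ) : Op K) = fracPow Q (-1) := by
    rw [Units.inv_eq_of_mul_eq_one_right]
    rw [hu, ← fracPow_add h0 h1, add_neg_cancel, fracPow_zero h0 h1]
  induction n with
  | zero => simpa using fracPow_zero h0 h1
  | succ n ih =>
    rw [zpow_add_one, Units.val_mul, ← ih, hu, ← fracPow_add h0 h1]
    simp
  | pred n ih =>
    rw [zpow_sub_one, Units.val_mul, ← ih, hinv, ← fracPow_add h0 h1]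
    simp [sub_eq_add_neg]

theorem isUmbralFor_fracPow [CharZero K] {Q : Op K}
    (h0 : PowerSeries.constantCoeff (indicator Q) = 0)
    (h1 : PowerSeries.coeff 1 (indicator Q) = 1) (s : K) :
    IsUnitaryOp (fracPow Q s) ∧ IsUmbralFor (fracPow Q s) (seriesOp (iter (indicator Q) s)) := by
  have hF := isIteration_iter h0 h1
  have hne : PowerSeries.coeff 1 (indicator Q) ≠ 0 := by rw [h1]; exact one_ne_zero
  have hc1 : PowerSeries.coeff 1 (iter (indicator Q) s) = 1 := by
    rw [iter, coeff_atParam, coeff_one_fractionalIteration h0 h1, Polynomial.eval_one]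
  have humb : IsUmbralFor (fracPow Q s) (seriesOp (iter (indicator Q) s)) := by
    refine isUmbralFor_of_pair_subst (finv := iter (indicator Q) (-s)) (isUnit_fracPow h0 h1 s)
      (hF.constantCoeff s) (by rw [hc1]; exact one_ne_zero) (hF.constantCoeff (-s)) ?_
      fun p h => ?_
    · have := hF.comp (-s) s
      rwa [neg_add_cancel, hF.zero hne] at this
    · rw [isTranspose_fracPow h0 h1 s, substL_apply, hF.subst_neg_subst hne]
  refine ⟨humb.isUnitaryOp_iff.2 ⟨humb.delta.1, ?_⟩, humb⟩
  have := seriesOp_X_pow (iter (indicator Q) s) 1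
  rw [pow_one, Finset.sum_range_succ, Finset.sum_range_one, hc1,
    PowerSeries.coeff_zero_eq_constantCoeff_apply, hF.constantCoeff] at this
  rw [this]
  simp [D]

end Field

section RCLike

variable {𝕜 : Type*} [RCLike 𝕜]

/-! ### The analytic case -/

theorem isDerivRule_hasDerivAt : IsDerivRule fun (f : 𝕜 → 𝕜) a => HasDerivAt f a 0 where
  const a := hasDerivAt_const _ _
  add hf hg := hf.add hg
  mul hf hg := by
    have := hf.mul hg
    rwa [add_comm] at this

/-- A solution of the linear equation with matrix `M` is given by the exponential series. -/
theorem hasSum_of_hasDerivAt_clm {E : Type*} [NormedAddCommGroup E] [NormedSpace 𝕜 E]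
    [CompleteSpace E] (M : E →L[𝕜] E) {v : 𝕜 → E} (hv : ∀ s, HasDerivAt v (M (v s)) s) (s : 𝕜) :
    HasSum (fun k : ℕ => (k.factorial : 𝕜)⁻¹ • ((s • M) ^ k) (v 0)) (v s) := by
  -- Variation of constants: e^(-uM) v(u) has zero derivative, hence equals v(0).
  have hw : ∀ u, HasDerivAt (fun u : 𝕜 => NormedSpace.exp (u • -M) (v u)) 0 u := by
    intro u
    convert (hasDerivAt_exp_smul_const (-M) u).clm_apply (hv u) using 1
    simp
  have hconst : NormedSpace.exp (s • -M) (v s) = v 0 := by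
    have := is_const_of_deriv_eq_zero (fun u => (hw u).differentiableAt) (fun u => (hw u).deriv) s 0
    simpa using this
  have hvs : NormedSpace.exp (s • M) (v 0) = v s := by
    have hmul : NormedSpace.exp (s • M) * NormedSpace.exp (s • -M) = 1 := by
      have hball : ∀ x : E →L[𝕜] E,
          x ∈ Metric.eball 0 (NormedSpace.expSeries 𝕜 (E →L[𝕜] E)).radius := fun x =>
        (NormedSpace.expSeries_radius_eq_top 𝕜 (E →L[𝕜] E)).symm ▸ edist_lt_top _ _
      rw [smul_neg, ← NormedSpace.exp_add_of_commute_of_mem_ball (𝕂 := 𝕜)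
        (Commute.refl (s • M)).neg_right (hball _) (hball _), add_neg_cancel,
        NormedSpace.exp_zero]
    rw [← hconst]
    exact DFunLike.congr_fun hmul (v s)
  rw [← hvs]
  have hexp := NormedSpace.exp_series_hasSum_exp' (𝕂 := 𝕜) (s • M)
  have hmap := hexp.mapL (ContinuousLinearMap.apply 𝕜 E (v 0))
  simpa only [ContinuousLinearMap.apply_apply, smul_apply] using hmap

/-- Differentiability at 0 is enough: h ∘ F (s + r) = (h ∘ F s) ∘ F r carries the derivative at r =
0 to every s. -/
theorem IsIteration.hasDerivAt_coeff_subst {f : 𝕜⟦X⟧} {F : 𝕜 → 𝕜⟦X⟧} {g : 𝕜⟦X⟧}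
    (hF : IsIteration f F) (h1 : PowerSeries.coeff 1 f ≠ 0) (hg : IsItlog F g)
    (hg0 : PowerSeries.constantCoeff g = 0) (h : 𝕜⟦X⟧) (n : ℕ) (s : 𝕜) :
    HasDerivAt (fun s => PowerSeries.coeff n (PowerSeries.subst (F s) h))
      (PowerSeries.coeff n (mulDeriv g (PowerSeries.subst (F s) h))) s := by
  have key := isDerivRule_hasDerivAt.coeff_subst (hF.zero h1) hF.constantCoeff hg0 hg
    (PowerSeries.subst (F s) h) n
  rw [← sub_self s] at key
  have := key.comp_sub_const s s
  simpa only [hF.subst_subst_apply, add_sub_cancel] using this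

theorem IsIteration.hasSum_coeff_subst {f : 𝕜⟦X⟧} {F : 𝕜 → 𝕜⟦X⟧} {g : 𝕜⟦X⟧}
    (hF : IsIteration f F) (h1 : PowerSeries.coeff 1 f ≠ 0) (hg : IsItlog F g)
    (hg0 : PowerSeries.constantCoeff g = 0) (h : 𝕜⟦X⟧) (n : ℕ) (s : 𝕜) :
    HasSum (fun k : ℕ => (k.factorial : 𝕜)⁻¹ *
      (s ^ k * PowerSeries.coeff n ((mulDeriv g ^ k) h)))
      (PowerSeries.coeff n (PowerSeries.subst (F s) h)) := by
  have hL : RaisesOrder (mulDeriv g) 0 :=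
    raisesOrder_mulDeriv (by simpa using PowerSeries.X_dvd_iff.2 hg0)
  -- As L preserves the order, the coefficients of L h up to degree n depend only on those of h; M
  -- is the resulting matrix.
  let tr : 𝕜⟦X⟧ → Fin (n + 1) → 𝕜 := fun h i => PowerSeries.coeff i h
  let M₀ : (Fin (n + 1) → 𝕜) →ₗ[𝕜] (Fin (n + 1) → 𝕜) :=
    Matrix.mulVecLin (Matrix.of fun i j : Fin (n + 1) =>
      PowerSeries.coeff i (mulDeriv g (PowerSeries.X ^ (j : ℕ))))
  let M : (Fin (n + 1) → 𝕜) →L[𝕜] (Fin (n + 1) → 𝕜) := LinearMap.toContinuousLinearMap M₀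
  have hM : ∀ h, M (tr h) = tr (mulDeriv g h) := by
    intro h
    ext i
    have hi : M (tr h) i = ∑ j : Fin (n + 1),
        PowerSeries.coeff i (mulDeriv g (PowerSeries.X ^ (j : ℕ))) * PowerSeries.coeff j h := rfl
    change _ = PowerSeries.coeff i (mulDeriv g h)
    rw [hi, hL.coeff_eq_sum h i.2, Finset.sum_range]
    exact Finset.sum_congr rfl fun j _ => mul_comm _ _
  have hMk : ∀ k h, (M ^ k) (tr h) = tr ((mulDeriv g ^ k) h) := by
    intro k
    induction k with
    | zero => intro h; rfl
    | succ k ih =>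
      intro h
      rw [pow_succ, pow_succ, Module.End.mul_apply, ← ih, ← hM]
      rfl
  have hsum := hasSum_of_hasDerivAt_clm M (v := fun s => tr (PowerSeries.subst (F s) h))
    (fun s => by
      rw [hM, hasDerivAt_pi]
      exact fun i => hF.hasDerivAt_coeff_subst h1 hg hg0 h i s) s
  have := Pi.hasSum.1 hsum (Fin.last n)
  simpa only [smul_pow, smul_apply, hF.zero h1, PowerSeries.X_subst, hMk,
    Pi.smul_apply, smul_eq_mul, tr, Fin.val_last] using this

theorem IsUmbralFor.hasOpExp {φ Q : Op 𝕜} (hφ : IsUmbralFor φ Q) {F : 𝕜 → 𝕜⟦X⟧} {g : 𝕜⟦X⟧}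
    (hF : IsIteration (indicator Q) F) (hg : IsItlog F g) :
    HasOpExp (-(mulX * seriesOp g)) φ := by
  have h1 := hφ.coeff_one_indicator_ne_zero
  have hg0 : PowerSeries.constantCoeff g = 0 := by
    have := hg 0
    simp only [PowerSeries.coeff_zero_eq_constantCoeff_apply, hF.constantCoeff] at this
    exact this.unique (hasDerivAt_const _ _)
  intro p n
  have hn : (n.factorial : 𝕜) ≠ 0 := Nat.cast_ne_zero.2 n.factorial_ne_zero
  have hterm : ∀ k : ℕ, ((k.factorial : 𝕜)⁻¹ • ((-(mulX * seriesOp g) : Op 𝕜) ^ k) p).coeff n =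
      (n.factorial : 𝕜)⁻¹ * ∑ i ∈ Finset.range (p.natDegree + 1), p.coeff i * (i.factorial *
        ((k.factorial : 𝕜)⁻¹ *
          ((-1) ^ k * PowerSeries.coeff i ((mulDeriv g ^ k) (PowerSeries.X ^ n))))) := by
    intro k
    have hU := (isTranspose_mulX_mul_seriesOp g).pow k p (PowerSeries.X ^ n)
    rw [pair_apply_X_pow, pair_eq_sum p _ p.natDegree.lt_succ_self] at hU
    have hpow := neg_smul_pow 1 (mulX * seriesOp g) k
    rw [one_smul] at hpow
    rw [hpow, LinearMap.smul_apply, Polynomial.coeff_smul, smul_eq_mul,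
      Polynomial.coeff_smul, smul_eq_mul, eq_inv_mul_iff_mul_eq₀ hn, mul_left_comm,
      mul_left_comm (n.factorial : 𝕜), hU, Finset.mul_sum,
      Finset.mul_sum]
    refine Finset.sum_congr rfl fun i _ => ?_
    ring
  have hsum := (hasSum_sum (s := Finset.range (p.natDegree + 1)) fun (i : ℕ) _ =>
    ((hF.hasSum_coeff_subst h1 hg hg0 (PowerSeries.X ^ n) i (-1)).mul_left
      (i.factorial : 𝕜)).mul_left (p.coeff i)).mul_left (n.factorial : 𝕜)⁻¹
  -- Pairing with t^n reads off n! times the n-th coefficient, and t^n = (t^n ∘ F (-1)) ∘ f brings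
  -- in φ.
  have hlim : (n.factorial : 𝕜)⁻¹ * ∑ i ∈ Finset.range (p.natDegree + 1), p.coeff i *
      (i.factorial * PowerSeries.coeff i (PowerSeries.subst (F (-1)) (PowerSeries.X ^ n : 𝕜⟦X⟧))) =
      (φ p).coeff n := by
    have h2 := hF.subst_neg_subst h1 (-1) (PowerSeries.X ^ n)
    rw [neg_neg, hF.one] at h2
    rw [← pair_eq_sum p _ p.natDegree.lt_succ_self, ← hφ.pair_subst p, h2, pair_apply_X_pow,
      inv_mul_cancel_left₀ hn]
  rw [hlim] at hsum
  simpa only [hterm] using hsum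

end RCLike

end

end Umbral

theorem mainTheorem2 :
    (∀ (K : Type*) [Field K] [CharZero K] (Q φ : Umbral.Op K), Umbral.IsUmbralFor φ Q →
      Umbral.seriesOp (Umbral.indicator Q) = Q ∧
      (Umbral.IsUnitaryOp φ ↔ Umbral.IsUnitaryDelta Q) ∧
      (Umbral.IsUnitaryOp φ →
        (∃! F, Umbral.IsFractionalIteration (Umbral.indicator Q) F) ∧
        Umbral.IsLocallyNilpotent (Umbral.mulX * Umbral.star Q) ∧
        φ = Umbral.opExp (-(Umbral.mulX * Umbral.star Q)) ∧
        (∀ r s : K, Umbral.fracPow Q (r + s) = Umbral.fracPow Q r * Umbral.fracPow Q s) ∧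
        (∀ n : ℤ, ∀ u : (Umbral.Op K)ˣ, (u : Umbral.Op K) = φ →
          Umbral.fracPow Q (n : K) = ((u ^ n : (Umbral.Op K)ˣ) : Umbral.Op K)) ∧
        (∀ s : K, Umbral.IsUnitaryOp (Umbral.fracPow Q s) ∧
          Umbral.IsUmbralFor (Umbral.fracPow Q s)
            (Umbral.seriesOp (Umbral.iter (Umbral.indicator Q) s))))) ∧
    (∀ (𝕜 : Type*) [RCLike 𝕜] (Q φ : Umbral.Op 𝕜), Umbral.IsUmbralFor φ Q →
      ∀ (F : 𝕜 → PowerSeries 𝕜) (g : PowerSeries 𝕜),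
        Umbral.IsIteration (Umbral.indicator Q) F → Umbral.IsItlog F g →
        Umbral.HasOpExp (-(Umbral.mulX * Umbral.seriesOp g)) φ) := by
  refine ⟨fun K _ _ Q φ hφ => ⟨Umbral.seriesOp_indicator hφ.delta.1, hφ.isUnitaryOp_iff,
    fun hu => ?_⟩, fun 𝕜 _ Q φ hφ F g hF hg => hφ.hasOpExp hF hg⟩
  have h0 := hφ.constantCoeff_indicator
  have h1 : PowerSeries.coeff 1 (Umbral.indicator Q) = 1 :=
    Umbral.coeff_one_indicator Q (hφ.isUnitaryOp_iff.1 hu).2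
  have hφ1 := hφ.eq_fracPow_one h1
  refine ⟨Umbral.existsUnique_isFractionalIteration h0 h1, fun p => ⟨p.natDegree + 1, ?_⟩, ?_,
    Umbral.fracPow_add h0 h1, fun n u hun => ?_, Umbral.isUmbralFor_fracPow h0 h1⟩
  · exact (Umbral.isTranspose_mulX_mul_seriesOp _).pow_apply_eq_zero
      (Umbral.raisesOrder_mulDeriv (Umbral.X_sq_dvd_itlog h0 h1)) p.natDegree.lt_succ_self
  · rwa [Umbral.fracPow, one_smul] at hφ1
  · exact Umbral.fracPow_intCast h0 h1 u (hun.trans hφ1) n
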